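/- For $m>0$ and $\rho>0$ let $\nu^{(m)}_\rho$ be the probability measure on $\{0,1,2,\dots\}$ given by $$\nu^{(m)}_\rho(n)=\frac{1}{z(\phi_m(\rho))}\,\phi_m(\rho)^n\,\frac{\Gamma(\frac m2+n)}{n!\,\Gamma(\frac m2)},\qquad \phi_m(\rho)=\frac{\rho}{m/2+\rho},\qquad z(\phi)=\sum_{n\ge 0}\phi^n\frac{\Gamma(\frac m2+n)}{n!\,\Gamma(\frac m2)} .$$ Fix $\rho>0$. For every $m>0$ let $\eta_1,\eta_2,\dots$ be i.i.d. random variables with law $\nu^{(m)}_\rho$ (on a probability space that may depend on $m$), let $K_m\ge 1$ be an integer, and let $\kappa_m=-1/(m\log m)$. Put $$\Delta_{K_m}=\#\{1\le i\le K_m:\eta_i\neq 0\},\qquad S_{K_m}=\frac1{K_m}\sum_{i=1}^{K_m}\eta_i .$$ Then the following hold as $m\to0^+$. (1) If $K_m/\kappa_m\to 0$, then $\Delta_{K_m}\to 0$ in distribution. If $K_m/\kappa_m\to\delta\in(0,\infty)$, then $\Delta_{K_m}$ converges in distribution to a Poisson random variable with mean $\delta/2$. If $K_m/\kappa_m\to\infty$,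 then $\Delta_{K_m}\to\infty$ in distribution (as $[0,\infty]$-valued random variables), and moreover $\Delta_{K_m}=\frac{K_m}{2\kappa_m}(1+o(1))$, i.e. $\Delta_{K_m}\big/\frac{K_m}{2\kappa_m}\to1$ in probability. (2) The scale $1/m$ is larger than $\kappa_m$, i.e. $(1/m)/\kappa_m\to\infty$. If $mK_m\to0$, then $S_{K_m}\to0$ in distribution. If $mK_m\to\gamma\in(0,\infty)$, then $S_{K_m}$ converges in distribution to a Gamma random variable with shape $\gamma/2$ and scale $2\rho/\gamma$, which has mean $\rho$. If $mK_m\to\infty$, then $S_{K_m}\to\rho$ in distribution. -/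

import Mathlib

open MeasureTheory ProbabilityTheory Filter Topology

open scoped ENNReal

noncomputable section

namespace InclusionProcess

/-- The weight `φⁿ Γ(m/2 + n) / (n! Γ(m/2))` of `n` particles at one site. -/
def weight (m φ : ℝ) (n : ℕ) : ℝ :=
  φ ^ n * (Real.Gamma (m / 2 + n) / (n.factorial * Real.Gamma (m / 2)))

/-- The normalizing constant `z(φ)`. -/
def z (m φ : ℝ) : ℝ := ∑' n : ℕ, weight m φ n

/-- The single-site marginal with fugacity `φ`, as a measure on `ℕ`. -/
def marginal (m φ : ℝ) : Measure ℕ :=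
  Measure.sum fun n : ℕ => ENNReal.ofReal ((z m φ)⁻¹ * weight m φ n) • Measure.dirac n

/-- The fugacity `φ_m(ρ)` at which the average number of particles per site is `ρ`. -/
def fugacity (m ρ : ℝ) : ℝ := ρ / (m / 2 + ρ)

/-- The single-site marginal `ν_ρ^{(m)}` indexed by the density `ρ`. -/
def nu (m ρ : ℝ) : Measure ℕ := marginal m (fugacity m ρ)

/-- The scale `κ_m = -1 / (m log m)`. -/
def kappa (m : ℝ) : ℝ := -1 / (m * Real.log m)

/-- The range of the parameter `m`. -/
abbrev Param : Type := {m : ℝ // 0 < m}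

/-- The limit `m → 0` through positive values. -/
def toZero : Filter Param := comap (fun m : Param => (m : ℝ)) (𝓝 0)

/-- `Δ_K`: the number of nonzero ones among the first `K` variables (numbered from `0`). -/
def numOccupied {Ω : Type*} (η : ℕ → Ω → ℕ) (K : ℕ) (ω : Ω) : ℕ :=
  ∑ i ∈ Finset.range K, if η i ω = 0 then 0 else 1

/-- `S_K`: the empirical mean of the first `K` variables. -/
def empiricalMean {Ω : Type*} (η : ℕ → Ω → ℕ) (K : ℕ) (ω : Ω) : ℝ :=
  (1 / (K : ℝ)) * ∑ i ∈ Finset.range K, (η i ω : ℝ)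

/-- `X i` converges in distribution, along `l`, to a random variable with law `ν`
(which is in particular a probability measure). A constant limit `c` is the law `dirac c`. -/
def TendstoInLaw {ι E : Type*} {Ω : ι → Type*} [∀ i, MeasurableSpace (Ω i)]
    [TopologicalSpace E] [MeasurableSpace E] [OpensMeasurableSpace E]
    (P : ∀ i, Measure (Ω i)) [∀ i, IsProbabilityMeasure (P i)]
    (X : ∀ i, Ω i → E) (l : Filter ι) (ν : Measure E) : Prop :=
  ∃ _ : IsProbabilityMeasure ν, TendstoInDistribution X l (fun x : E => x) P ν

end InclusionProcess

end

/-! The number of occupied sites is binomial, with success probability `1 - ν(0) ∼ 1 / (2 κ_m)`: by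
the negative binomial series, `ν(0) = (1 + 2 ρ / m) ^ (-m / 2) = 1 + (m / 2) log m (1 + o(1))`.
Characteristic functions then give the Poisson limits, and Chebyshev's inequality the concentration.

The same series yields the characteristic function `(1 + y / s) ^ (-s)` of the empirical mean, where
`s = K m / 2` and `y = ρ K (1 - e^{it/K})` stays bounded in the right half plane and tends to
`-iρt` as `K → ∞`. Letting `s` tend to `0`, to `γ / 2` or to infinity, one finds the characteristic
functions of `0`, of the Gamma law and of `ρ`, and Lévy's continuity theorem concludes.
-/

open Asymptotics

open scoped NNReal

namespace InclusionProcess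

section GammaLaw

variable {a r : ℝ}

lemma integral_gammaMeasure {E : Type*} [NormedAddCommGroup E] [NormedSpace ℝ E]
    (ha : 0 < a) (hr : 0 < r) (f : ℝ → E) :
    ∫ x, f x ∂(gammaMeasure a r) =
      ∫ x in Set.Ioi 0, (r ^ a / Real.Gamma a * x ^ (a - 1) * Real.exp (-(r * x))) • f x := by
  have hmeas : Measurable (gammaPDF a r) := (measurable_gammaPDFReal a r).ennreal_ofReal
  rw [gammaMeasure, integral_withDensity_eq_integral_toReal_smul hmeas (by simp [gammaPDF]),
    ← integral_Ici_eq_integral_Ioi, ← integral_indicator measurableSet_Ici]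
  congr with x
  rw [gammaPDF, ENNReal.toReal_ofReal (gammaPDFReal_nonneg ha hr x), gammaPDFReal]
  by_cases hx : 0 ≤ x <;> simp [hx]

lemma integral_id_gammaMeasure (ha : 0 < a) (hr : 0 < r) :
    ∫ x, x ∂(gammaMeasure a r) = a / r := by
  have hdensity : ∀ x ∈ Set.Ioi (0 : ℝ),
      (r ^ a / Real.Gamma a * x ^ (a - 1) * Real.exp (-(r * x))) • x =
        r ^ a / Real.Gamma a * (x ^ ((a + 1) - 1) * Real.exp (-(r * x))) := fun x hx => by
    have hx0 : x ≠ 0 := ne_of_gt hx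
    rw [add_sub_cancel_right, Real.rpow_sub_one hx0, smul_eq_mul]
    field_simp
  have hΓ := (Real.Gamma_pos_of_pos ha).ne'
  rw [integral_gammaMeasure ha hr, setIntegral_congr_fun measurableSet_Ioi hdensity,
    integral_const_mul, Real.integral_rpow_mul_exp_neg_mul_Ioi (by linarith) hr,
    Real.Gamma_add_one ha.ne', Real.rpow_add_one (by positivity), one_div, Real.inv_rpow hr.le]
  field_simp

lemma integrable_id_gammaMeasure (ha : 0 < a) (hr : 0 < r) :
    Integrable (fun x : ℝ => x) (gammaMeasure a r) :=
  .of_integral_ne_zero ((integral_id_gammaMeasure ha hr).trans_ne (div_pos ha hr).ne')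

lemma mgf_id_gammaMeasure (ha : 0 < a) (hr : 0 < r) {s : ℝ} (hs : s < r) :
    mgf id (gammaMeasure a r) s = (1 - s / r) ^ (-a) := by
  have hdensity : ∀ x : ℝ,
      (r ^ a / Real.Gamma a * x ^ (a - 1) * Real.exp (-(r * x))) • Real.exp (s * x) =
        r ^ a / Real.Gamma a * (x ^ (a - 1) * Real.exp (-((r - s) * x))) := fun x => by
    rw [smul_eq_mul, mul_assoc, ← Real.exp_add, mul_assoc]
    ring_nf
  have hrs : 0 < r - s := sub_pos.2 hs
  have hΓ := (Real.Gamma_pos_of_pos ha).ne'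
  simp only [mgf, id]
  rw [integral_gammaMeasure ha hr]
  simp_rw [hdensity]
  rw [integral_const_mul, Real.integral_rpow_mul_exp_neg_mul_Ioi ha hrs, one_sub_div hr.ne',
    one_div, Real.inv_rpow hrs.le, Real.rpow_neg (by positivity), Real.div_rpow hrs.le hr.le]
  field_simp

lemma one_sub_div_pos_of_lt (hr : 0 < r) {s : ℝ} (hs : s < r) : 0 < 1 - s / r :=
  sub_pos.2 ((div_lt_one hr).2 hs)

lemma Iio_subset_integrableExpSet_gammaMeasure (ha : 0 < a) (hr : 0 < r) :
    Set.Iio r ⊆ integrableExpSet id (gammaMeasure a r) := fun _ hs =>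
  .of_integral_ne_zero <| (mgf_id_gammaMeasure ha hr hs).trans_ne
    (Real.rpow_pos_of_pos (one_sub_div_pos_of_lt hr hs) _).ne'

lemma complexMGF_id_gammaMeasure (ha : 0 < a) (hr : 0 < r) {w : ℂ} (hw : w.re < r) :
    complexMGF id (gammaMeasure a r) w = (1 - w / r) ^ (-a : ℂ) := by
  let U : Set ℂ := {w | w.re < r}
  have h0U : (0 : ℂ) ∈ U := by simpa [U] using hr
  have hU : IsPreconnected U := (convex_halfSpace_re_lt r).isPreconnected
  have hmgf : AnalyticOnNhd ℂ (complexMGF id (gammaMeasure a r)) U :=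
    analyticOnNhd_complexMGF.mono fun w hw =>
      interior_maximal (Iio_subset_integrableExpSet_gammaMeasure ha hr) isOpen_Iio hw
  have hcpow : AnalyticOnNhd ℂ (fun w : ℂ => (1 - w / r) ^ (-a : ℂ)) U := fun w hw => by
    refine AnalyticAt.cpow (by fun_prop) analyticAt_const (Or.inl ?_)
    rw [Complex.sub_re, Complex.div_ofReal_re, Complex.one_re]
    exact one_sub_div_pos_of_lt hr hw
  -- The identity theorem: both sides agree at the real points near `0`.
  have hreal : ∃ᶠ s : ℝ in 𝓝[≠] 0,
      complexMGF id (gammaMeasure a r) s = (1 - s / r : ℂ) ^ (-a : ℂ) := by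
    refine (eventually_nhdsWithin_of_eventually_nhds ?_).frequently
    filter_upwards [eventually_lt_nhds hr] with s hs
    rw [complexMGF_ofReal, mgf_id_gammaMeasure ha hr hs,
      Complex.ofReal_cpow (one_sub_div_pos_of_lt hr hs).le]
    push_cast
    rfl
  have hofReal : Tendsto ((↑) : ℝ → ℂ) (𝓝[≠] 0) (𝓝[≠] 0) := by
    simpa using Complex.continuous_ofReal.continuousWithinAt.tendsto_nhdsWithin (x := 0)
      (s := {0}ᶜ) (t := {0}ᶜ) (by intro s hs; simpa using hs)
  exact hmgf.eqOn_of_preconnected_of_frequently_eq hcpow hU h0U (hofReal.frequently hreal) hw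

lemma charFun_gammaMeasure (ha : 0 < a) (hr : 0 < r) (t : ℝ) :
    charFun (gammaMeasure a r) t = (1 - t * Complex.I / r) ^ (-a : ℂ) := by
  rw [← complexMGF_id_mul_I, complexMGF_id_gammaMeasure ha hr (by simpa using hr)]

end GammaLaw

section CharacteristicFunctionLimits

variable {ι : Type*} {l : Filter ι}

lemma tendsto_one_add_cpow_exp {k y : ι → ℂ} {c : ℂ} (hy : Tendsto y l (𝓝 0))
    (hky : Tendsto (fun i => k i * y i) l (𝓝 c)) :
    Tendsto (fun i => (1 + y i) ^ k i) l (𝓝 (Complex.exp c)) := by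
  have hlog : (fun i => Complex.log (1 + y i) - y i) =o[l] y :=
    (Complex.log_sub_self_isBigO.comp_tendsto hy).trans_isLittleO <| by
      simpa [Function.comp_def] using (isLittleO_pow_id (𝕜 := ℂ) one_lt_two).comp_tendsto hy
  have hequiv : (fun i => k i * Complex.log (1 + y i)) ~[l] fun i => k i * y i :=
    IsEquivalent.refl.mul hlog
  refine ((hequiv.symm.tendsto_nhds hky).cexp).congr' ?_
  filter_upwards [hy.eventually_ne (neg_ne_zero.2 one_ne_zero).symm] with i hi
  rw [Complex.cpow_def_of_ne_zero fun h => hi (eq_neg_of_add_eq_zero_right h), mul_comm]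

lemma norm_log_le_log_norm_add_pi {v : ℂ} (hv : 1 ≤ ‖v‖) :
    ‖Complex.log v‖ ≤ Real.log ‖v‖ + Real.pi := by
  refine (Complex.norm_le_abs_re_add_abs_im _).trans (add_le_add ?_ ?_)
  · rw [Complex.log_re, abs_of_nonneg (Real.log_nonneg hv)]
  · rw [Complex.log_im]
    exact Complex.abs_arg_le_pi v

lemma norm_mul_log_one_add_div_le {s C : ℝ} {y : ℂ} (hs : 0 < s) (hC : 0 < C) (hre : 0 ≤ y.re)
    (hy : ‖y‖ ≤ C) :
    ‖s * Complex.log (1 + y / s)‖ ≤ s * Real.log (s + C) - s * Real.log s + s * Real.pi := by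
  have hone : 1 ≤ ‖1 + y / s‖ := by
    refine le_trans ?_ (Complex.re_le_norm _)
    rw [Complex.add_re, Complex.div_ofReal_re, Complex.one_re]
    exact le_add_of_nonneg_right (div_nonneg hre hs.le)
  have hnorm : ‖1 + y / s‖ ≤ (s + C) / s := by
    refine (norm_add_le _ _).trans ?_
    rw [norm_one, norm_div, Complex.norm_of_nonneg hs.le, add_div, div_self hs.ne']
    gcongr
  calc ‖s * Complex.log (1 + y / s)‖ = s * ‖Complex.log (1 + y / s)‖ := by
        rw [norm_mul, Complex.norm_of_nonneg hs.le]
    _ ≤ s * (Real.log ((s + C) / s) + Real.pi) := by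
        gcongr
        exact (norm_log_le_log_norm_add_pi hone).trans (by gcongr)
    _ = s * Real.log (s + C) - s * Real.log s + s * Real.pi := by
        rw [Real.log_div (by positivity) hs.ne']
        ring

variable {s : ι → ℝ} {y : ι → ℂ}

lemma tendsto_one_add_div_cpow_neg_zero {C : ℝ} (hs0 : ∀ᶠ i in l, 0 ≤ s i)
    (hs : Tendsto s l (𝓝 0)) (hre : ∀ i, 0 ≤ (y i).re) (hC : ∀ i, ‖y i‖ ≤ C) :
    Tendsto (fun i => (1 + y i / s i) ^ (-s i : ℂ)) l (𝓝 1) := by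
  have hbound : Tendsto
      (fun i => s i * Real.log (s i + (|C| + 1)) - s i * Real.log (s i) + s i * Real.pi) l
      (𝓝 0) := by
    have hlog := (hs.add_const (|C| + 1)).log (by positivity)
    have hmul_log := (Real.continuous_mul_log.tendsto 0).comp hs
    simpa using ((hs.mul hlog).sub hmul_log).add (hs.mul_const Real.pi)
  have hexponent : Tendsto (fun i => s i * Complex.log (1 + y i / s i)) l (𝓝 0) := by
    refine squeeze_zero_norm' ?_ hbound
    filter_upwards [hs0] with i hi
    rcases hi.eq_or_lt with hi | hi
    · simp [← hi]
    · exact norm_mul_log_one_add_div_le hi (by positivity) (hre i)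
        ((hC i).trans ((le_abs_self C).trans (lt_add_one _).le))
  have hexp := hexponent.neg.cexp
  rw [neg_zero, Complex.exp_zero] at hexp
  refine hexp.congr' ?_
  filter_upwards [hs0] with i hi
  have hne : 1 + y i / s i ≠ 0 := by
    refine Complex.ne_zero_of_re_pos ?_
    rw [Complex.add_re, Complex.div_ofReal_re, Complex.one_re]
    linarith [div_nonneg (hre i) hi]
  rw [Complex.cpow_def_of_ne_zero hne]
  ring_nf

lemma tendsto_one_add_div_cpow_neg_atTop {y₀ : ℂ} (hs : Tendsto s l atTop)
    (hy : Tendsto y l (𝓝 y₀)) :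
    Tendsto (fun i => (1 + y i / s i) ^ (-s i : ℂ)) l (𝓝 (Complex.exp (-y₀))) := by
  have hinv : Tendsto (fun i => ((s i : ℂ))⁻¹) l (𝓝 0) := by
    simpa using (tendsto_inv_atTop_zero.comp hs).ofReal
  refine tendsto_one_add_cpow_exp (by simpa [div_eq_mul_inv] using hy.mul hinv) ?_
  refine hy.neg.congr' ?_
  filter_upwards [hs.eventually_ne_atTop 0] with i hi
  have : (s i : ℂ) ≠ 0 := by exact_mod_cast hi
  field_simp

end CharacteristicFunctionLimits

section ConvergenceInLaw

variable {ι : Type*} {l : Filter ι} {Ω : ι → Type*} [∀ i, MeasurableSpace (Ω i)]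
  {P : ∀ i, Measure (Ω i)}

lemma tendsto_measure_le_of_tendsto_measure_abs_div_sub_one {X : ∀ i, Ω i → ℝ} {L : ι → ℝ}
    (hL : Tendsto L l atTop)
    (h : ∀ ε, 0 < ε → Tendsto (fun i => P i {ω | ε ≤ |X i ω / L i - 1|}) l (𝓝 0)) (c : ℝ) :
    Tendsto (fun i => P i {ω | X i ω ≤ c}) l (𝓝 0) := by
  refine tendsto_of_tendsto_of_tendsto_of_le_of_le' tendsto_const_nhds (h (1 / 2) one_half_pos)
    (Eventually.of_forall fun _ => zero_le) ?_
  filter_upwards [hL.eventually_gt_atTop 0, hL.eventually_ge_atTop (2 * c)] with i hi hci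
  refine measure_mono fun ω (hω : X i ω ≤ c) => ?_
  have hhalf : X i ω / L i ≤ 1 / 2 := by
    rw [div_le_iff₀ hi]
    linarith
  change 1 / 2 ≤ |X i ω / L i - 1|
  rw [abs_of_neg (by linarith)]
  linarith

variable [∀ i, IsProbabilityMeasure (P i)]

lemma tendstoInLaw_of_tendsto_charFun [l.IsCountablyGenerated] {X : ∀ i, Ω i → ℝ}
    {ν : Measure ℝ} [IsProbabilityMeasure ν] (hX : ∀ i, AEMeasurable (X i) (P i))
    (h : ∀ t, Tendsto (fun i => charFun ((P i).map (X i)) t) l (𝓝 (charFun ν t))) :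
    TendstoInLaw P X l ν := by
  refine ⟨inferInstance, hX, aemeasurable_id, tendsto_of_seq_tendsto fun u hu => ?_⟩
  refine ProbabilityMeasure.tendsto_of_tendsto_charFun fun t => ?_
  have hseq := (h t).comp hu
  rw [← Measure.map_id' (μ := ν)] at hseq
  exact hseq

lemma TendstoInLaw.of_natCast {X : ∀ i, Ω i → ℕ} {ν : Measure ℕ} [IsProbabilityMeasure ν]
    (hX : ∀ i, AEMeasurable (X i) (P i))
    (h : TendstoInLaw P (fun i ω => (X i ω : ℝ)) l (ν.map (Nat.cast : ℕ → ℝ))) :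
    TendstoInLaw P X l ν := by
  obtain ⟨_, h⟩ := h
  refine ⟨inferInstance, hX, aemeasurable_id,
    ProbabilityMeasure.tendsto_iff_forall_integral_tendsto.2 fun f => ?_⟩
  -- `ℕ` is closed in `ℝ`, so every bounded test function extends.
  obtain ⟨g, -, hg⟩ := BoundedContinuousFunction.exists_extension_norm_eq_of_isClosedEmbedding f
    Nat.isClosedEmbedding_coe_real
  have hgf : ∀ n : ℕ, g n = f n := congrFun hg
  have htest := ProbabilityMeasure.tendsto_iff_forall_integral_tendsto.1 h.tendsto g
  simp only [ProbabilityMeasure.coe_mk, Measure.map_id'] at htest ⊢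
  rw [integral_map (by fun_prop) (by fun_prop)] at htest
  simp_rw [integral_map (h.forall_aemeasurable _) g.continuous.aestronglyMeasurable, hgf] at htest
  simpa only [integral_map (hX _) f.continuous.aestronglyMeasurable] using htest

lemma tendstoInLaw_dirac_top [l.IsCountablyGenerated] {X : ∀ i, Ω i → ℝ≥0∞}
    (hX : ∀ i, AEMeasurable (X i) (P i))
    (h : ∀ c < ∞, Tendsto (fun i => P i {ω | X i ω ≤ c}) l (𝓝 0)) :
    TendstoInLaw P X l (Measure.dirac ∞) := by
  refine ⟨inferInstance, hX, aemeasurable_id, ?_⟩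
  refine tendsto_of_forall_isOpen_le_liminf' fun G hG => ?_
  change (Measure.dirac ∞).map (fun x : ℝ≥0∞ => x) G ≤ l.liminf fun i => (P i).map (X i) G
  rw [Measure.map_id', Measure.dirac_apply' _ hG.measurableSet]
  by_cases htop : ∞ ∈ G
  swap
  · simp [htop]
  rcases l.eq_or_neBot with rfl | _
  · simp
  obtain ⟨c, hc, hcG⟩ := ENNReal.nhds_top_basis.mem_iff.1 (hG.mem_nhds htop)
  have hlim : Tendsto (fun i => 1 - P i {ω | X i ω ≤ c}) l (𝓝 1) := by
    simpa using ENNReal.Tendsto.sub tendsto_const_nhds (h c hc) (Or.inl ENNReal.one_ne_top)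
  rw [Set.indicator_of_mem htop, Pi.one_apply, ← hlim.liminf_eq]
  refine liminf_le_liminf (Eventually.of_forall fun i => ?_)
  rw [Measure.map_apply_of_aemeasurable (hX i) hG.measurableSet, tsub_le_iff_right,
    ← measure_univ (μ := P i)]
  refine (measure_mono fun ω _ => ?_).trans (measure_union_le _ _)
  rcases le_or_gt (X i ω) c with hω | hω
  · exact Or.inr hω
  · exact Or.inl (hcG hω)

lemma tendsto_measure_abs_div_sub_one_ge {X : ∀ i, Ω i → ℝ} {L : ι → ℝ}
    (hX : ∀ i, MemLp (X i) 2 (P i)) (hL : ∀ᶠ i in l, L i ≠ 0)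
    (hmean : (fun i => (P i)[X i]) ~[l] L)
    (hvar : (fun i => Var[X i; P i]) =o[l] fun i => L i ^ 2) {ε : ℝ} (hε : 0 < ε) :
    Tendsto (fun i => P i {ω | ε ≤ |X i ω / L i - 1|}) l (𝓝 0) := by
  have hbound : Tendsto (fun i => ENNReal.ofReal (Var[X i; P i] / (|L i| * (ε / 2)) ^ 2)) l
      (𝓝 0) := by
    have hreal := hvar.tendsto_div_nhds_zero.div_const ((ε / 2) ^ 2)
    simpa [mul_pow, div_div] using ENNReal.tendsto_ofReal hreal
  refine tendsto_of_tendsto_of_tendsto_of_le_of_le' tendsto_const_nhds hbound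
    (Eventually.of_forall fun _ => zero_le) ?_
  have hratio : Tendsto (fun i => (P i)[X i] / L i) l (𝓝 1) :=
    (isEquivalent_iff_tendsto_one hL).1 hmean
  filter_upwards [hratio.eventually (Metric.ball_mem_nhds 1 (half_pos hε)), hL] with i hi hLi
  rw [Real.dist_eq] at hi
  refine (measure_mono fun ω (hω : ε ≤ |X i ω / L i - 1|) => ?_).trans
    (meas_ge_le_variance_div_sq (hX i) (by positivity))
  have hsplit : X i ω - (P i)[X i] = L i * ((X i ω / L i - 1) - ((P i)[X i] / L i - 1)) := by
    field_simp
    ring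
  change |L i| * (ε / 2) ≤ |X i ω - (P i)[X i]|
  rw [hsplit, abs_mul]
  gcongr
  linarith [abs_sub_abs_le_abs_sub (X i ω / L i - 1) ((P i)[X i] / L i - 1)]

end ConvergenceInLaw

section IIDSums

variable {Ω : Type*} [MeasurableSpace Ω] {P : Measure Ω}

lemma charFun_map_sum_range {X : ℕ → Ω → ℝ} {ν : Measure ℝ} (hlaw : ∀ i, HasLaw (X i) ν P)
    (hindep : iIndepFun X P) (K : ℕ) (t : ℝ) :
    charFun (P.map fun ω => ∑ i ∈ Finset.range K, X i ω) t = charFun ν t ^ K := by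
  rw [iIndepFun.charFun_map_fun_finsetSum_eq_prod (fun i _ => (hlaw i).aemeasurable)
    (hindep.restrict _)]
  simp [(hlaw _).map_eq]

variable {η : ℕ → Ω → ℕ} {μ : Measure ℕ}

lemma aemeasurable_numOccupied (hη : ∀ i, AEMeasurable (η i) P) (K : ℕ) :
    AEMeasurable (numOccupied η K) P :=
  Finset.aemeasurable_fun_sum _ fun i _ =>
    (Measurable.of_discrete (f := fun n : ℕ => if n = 0 then 0 else 1)).comp_aemeasurable (hη i)

lemma aemeasurable_empiricalMean (hη : ∀ i, AEMeasurable (η i) P) (K : ℕ) :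
    AEMeasurable (empiricalMean η K) P :=
  (Finset.aemeasurable_fun_sum _ fun i _ =>
    (Measurable.of_discrete (f := fun n : ℕ => (n : ℝ))).comp_aemeasurable (hη i)).const_mul _

/-- Whether a site with `n` particles is occupied, as a real number `0` or `1`. -/
noncomputable def occupation : ℕ → ℝ := ({0}ᶜ : Set ℕ).indicator 1

lemma natCast_numOccupied {Ω : Type*} (η : ℕ → Ω → ℕ) (K : ℕ) (ω : Ω) :
    (numOccupied η K ω : ℝ) = ∑ i ∈ Finset.range K, occupation (η i ω) := by
  simp [numOccupied, occupation, Set.indicator_apply]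

lemma occupation_mem (n : ℕ) : occupation n = 0 ∨ occupation n = 1 := by
  by_cases hn : n = 0 <;> simp [occupation, hn]

lemma iIndepFun_occupation (hindep : iIndepFun η P) :
    iIndepFun (fun i ω => occupation (η i ω)) P :=
  hindep.comp (fun _ => occupation) fun _ => .of_discrete

section SingleSite

variable {X : Ω → ℕ}

lemma integral_occupation (hX : HasLaw X μ P) : ∫ ω, occupation (X ω) ∂P = μ.real {0}ᶜ := by
  rw [← integral_indicator_one (measurableSet_singleton 0).compl]
  exact hX.integral_comp (f := occupation) (by fun_prop)

lemma memLp_occupation [IsFiniteMeasure P] (hX : AEMeasurable X P) :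
    MemLp (fun ω => occupation (X ω)) 2 P :=
  .of_bound (Measurable.of_discrete.comp_aemeasurable hX).aestronglyMeasurable 1
    (Eventually.of_forall fun ω => by rcases occupation_mem (X ω) with h | h <;> simp [h])

lemma variance_occupation_le [IsProbabilityMeasure P] (hX : HasLaw X μ P) :
    Var[fun ω => occupation (X ω); P] ≤ μ.real {0}ᶜ := by
  have hsq : ∀ n, occupation n ^ 2 = occupation n := fun n => by
    rcases occupation_mem n with h | h <;> simp [h]
  refine (variance_le_expectation_sq
    (memLp_occupation hX.aemeasurable).aestronglyMeasurable).trans_eq ?_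
  simp only [Pi.pow_apply, hsq, integral_occupation hX]

lemma charFun_map_occupation [IsProbabilityMeasure P] (hX : HasLaw X μ P) (t : ℝ) :
    charFun (P.map fun ω => occupation (X ω)) t =
      1 + μ.real {0}ᶜ * (Complex.exp (t * Complex.I) - 1) := by
  have hX' := memLp_occupation hX.aemeasurable
  have hsplit : ∀ n, Complex.exp (t * occupation n * Complex.I) =
      1 + occupation n * (Complex.exp (t * Complex.I) - 1) := fun n => by
    rcases occupation_mem n with h | h <;> simp [h]
  rw [charFun_apply_real, integral_map hX'.aemeasurable (by fun_prop)]
  simp_rw [hsplit]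
  rw [integral_add (integrable_const _) ((hX'.integrable one_le_two).ofReal.mul_const _),
    integral_mul_const, integral_complex_ofReal, integral_occupation hX]
  simp

end SingleSite

lemma memLp_numOccupied [IsFiniteMeasure P] (hη : ∀ i, AEMeasurable (η i) P) (K : ℕ) :
    MemLp (fun ω => (numOccupied η K ω : ℝ)) 2 P := by
  simp_rw [natCast_numOccupied]
  exact memLp_finsetSum _ fun i _ => memLp_occupation (hη i)

lemma integral_numOccupied [IsFiniteMeasure P] (hlaw : ∀ i, HasLaw (η i) μ P) (K : ℕ) :
    ∫ ω, (numOccupied η K ω : ℝ) ∂P = K * μ.real {0}ᶜ := by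
  simp_rw [natCast_numOccupied]
  rw [integral_finsetSum _ fun i _ =>
    (memLp_occupation (hlaw i).aemeasurable).integrable one_le_two]
  simp only [integral_occupation (hlaw _), Finset.sum_const, Finset.card_range, nsmul_eq_mul]

variable [IsProbabilityMeasure P]

lemma charFun_map_numOccupied (hlaw : ∀ i, HasLaw (η i) μ P) (hindep : iIndepFun η P) (K : ℕ)
    (t : ℝ) :
    charFun (P.map fun ω => (numOccupied η K ω : ℝ)) t =
      (1 + μ.real {0}ᶜ * (Complex.exp (t * Complex.I) - 1)) ^ K := by
  have hlaw' : ∀ i, HasLaw (fun ω => occupation (η i ω)) (μ.map occupation) P := fun i =>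
    HasLaw.fun_comp (Y := occupation) ⟨Measurable.of_discrete.aemeasurable, rfl⟩ (hlaw i)
  simp_rw [natCast_numOccupied]
  rw [charFun_map_sum_range hlaw' (iIndepFun_occupation hindep), ← (hlaw' 0).map_eq,
    charFun_map_occupation (hlaw 0)]

lemma variance_numOccupied_le (hlaw : ∀ i, HasLaw (η i) μ P) (hindep : iIndepFun η P) (K : ℕ) :
    Var[fun ω => (numOccupied η K ω : ℝ); P] ≤ K * μ.real {0}ᶜ := by
  have hsum : (fun ω => (numOccupied η K ω : ℝ)) =
      ∑ i ∈ Finset.range K, fun ω => occupation (η i ω) := by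
    ext ω
    rw [natCast_numOccupied, Finset.sum_apply]
  rw [hsum, IndepFun.variance_sum (fun i _ => memLp_occupation (hlaw i).aemeasurable)
    fun i _ j _ hij => (iIndepFun_occupation hindep).indepFun hij]
  simpa using Finset.sum_le_sum fun i (_ : i ∈ Finset.range K) => variance_occupation_le (hlaw i)

end IIDSums

section Occupation

variable {ι : Type*} {l : Filter ι} {Ω : ι → Type*} [∀ i, MeasurableSpace (Ω i)]
  {P : ∀ i, Measure (Ω i)} [∀ i, IsProbabilityMeasure (P i)] {η : ∀ i, ℕ → Ω i → ℕ}
  {μ : ι → Measure ℕ} {K : ι → ℕ}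

lemma tendstoInLaw_numOccupied_poisson [l.IsCountablyGenerated]
    (hlaw : ∀ i j, HasLaw (η i j) (μ i) (P i)) (hindep : ∀ i, iIndepFun (η i) (P i)) {r : ℝ≥0}
    (hμ : Tendsto (fun i => (μ i).real {0}ᶜ) l (𝓝 0))
    (hK : Tendsto (fun i => K i * (μ i).real {0}ᶜ) l (𝓝 r)) :
    TendstoInLaw P (fun i ω => numOccupied (η i) (K i) ω) l (poissonMeasure r) := by
  have hmeas : ∀ i, AEMeasurable (numOccupied (η i) (K i)) (P i) := fun i =>
    aemeasurable_numOccupied (fun j => (hlaw i j).aemeasurable) _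
  refine .of_natCast hmeas (tendstoInLaw_of_tendsto_charFun
    (fun i => Measurable.of_discrete.comp_aemeasurable (hmeas i)) fun t => ?_)
  simp_rw [charFun_map_numOccupied (hlaw _) (hindep _), charFun_map_cast_poissonMeasure,
    ← Complex.cpow_natCast]
  refine tendsto_one_add_cpow_exp ?_ ?_
  · simpa using hμ.ofReal.mul_const (Complex.exp (t * Complex.I) - 1)
  · simpa [mul_assoc] using hK.ofReal.mul_const (Complex.exp (t * Complex.I) - 1)

lemma poissonMeasure_zero : poissonMeasure 0 = Measure.dirac 0 := by
  refine Measure.ext_of_singleton fun n => ?_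
  rw [poissonMeasure_singleton]
  cases n <;> simp

lemma tendsto_measure_abs_numOccupied_div_sub_one_ge
    (hlaw : ∀ i j, HasLaw (η i j) (μ i) (P i)) (hindep : ∀ i, iIndepFun (η i) (P i)) {L : ι → ℝ}
    (hL : Tendsto L l atTop) (hK : (fun i => K i * (μ i).real {0}ᶜ) ~[l] L) {ε : ℝ} (hε : 0 < ε) :
    Tendsto (fun i => P i {ω | ε ≤ |(numOccupied (η i) (K i) ω : ℝ) / L i - 1|}) l (𝓝 0) := by
  refine tendsto_measure_abs_div_sub_one_ge
    (fun i => memLp_numOccupied (fun j => (hlaw i j).aemeasurable) (K i))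
    (hL.eventually_ne_atTop 0) ?_ ?_ hε
  · simpa only [integral_numOccupied (hlaw _)] using hK
  · have hvar : (fun i => Var[fun ω => (numOccupied (η i) (K i) ω : ℝ); P i]) =O[l] L :=
      (IsBigO.of_norm_le fun i => by
        rw [Real.norm_of_nonneg (variance_nonneg _ _)]
        exact variance_numOccupied_le (hlaw i) (hindep i) (K i)).trans hK.isBigO
    refine hvar.trans_isLittleO ?_
    simpa [Function.comp_def] using (isLittleO_pow_pow_atTop_of_lt one_lt_two).comp_tendsto hL

end Occupation

section NegativeBinomial

variable {m φ ρ : ℝ}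

lemma ofReal_mul_cpow {a : ℝ} {w : ℂ} (ha : 0 < a) (hw : w ≠ 0) (s : ℂ) :
    (a * w) ^ s = (a : ℂ) ^ s * w ^ s := by
  have ha' : (a : ℂ) ≠ 0 := by exact_mod_cast ha.ne'
  rw [Complex.cpow_def_of_ne_zero (mul_ne_zero ha' hw), Complex.log_ofReal_mul ha hw,
    Complex.cpow_def_of_ne_zero ha', Complex.cpow_def_of_ne_zero hw, ← Complex.ofReal_log ha.le,
    add_mul, Complex.exp_add]

lemma weight_eq_multichoose (hm : 0 < m) (φ : ℝ) (n : ℕ) :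
    weight m φ n = φ ^ n * Ring.multichoose (m / 2) n := by
  have hΓ : Real.Gamma (m / 2) ≠ 0 := (Real.Gamma_pos_of_pos (half_pos hm)).ne'
  have hshift : Real.Gamma (m / 2 + n) / Real.Gamma (m / 2) =
      (ascPochhammer ℝ n).eval (m / 2) := by
    induction n with
    | zero => simp [hΓ]
    | succ n ih =>
      rw [ascPochhammer_succ_eval, ← ih, Nat.cast_succ, ← add_assoc,
        Real.Gamma_add_one (by positivity)]
      ring
  have hchoose : n.factorial * Ring.multichoose (m / 2) n = (ascPochhammer ℝ n).eval (m / 2) := by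
    rw [← nsmul_eq_mul, Ring.factorial_nsmul_multichoose_eq_ascPochhammer,
      Polynomial.ascPochhammer_smeval_eq_eval]
  rw [weight, mul_comm (n.factorial : ℝ), ← div_div, hshift, ← hchoose,
    mul_div_cancel_left₀ _ (by positivity)]

lemma hasSum_weight_mul_pow (hm : 0 < m) {w : ℂ} (hw : ‖φ * w‖ < 1) :
    HasSum (fun n => weight m φ n * w ^ n) ((1 - φ * w) ^ (-(m / 2) : ℂ)) := by
  have hmem : φ * w ∈ Metric.eball (0 : ℂ) 1 := by
    rwa [← ENNReal.ofReal_one, Metric.eball_ofReal, mem_ball_zero_iff]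
  have hbinomial :=
    (Complex.one_div_one_sub_cpow_hasFPowerSeriesOnBall_zero (m / 2 : ℂ)).hasSum hmem
  rw [zero_add, one_div, ← Complex.cpow_neg] at hbinomial
  refine hbinomial.congr_fun fun n => ?_
  have hcast : ((Ring.choose (m / 2 + n - 1) n : ℝ) : ℂ) = Ring.choose ((m / 2 : ℂ) + n - 1) n := by
    push_cast
    rfl
  rw [weight_eq_multichoose hm, Ring.multichoose_eq, Complex.ofReal_mul, hcast]
  simp [mul_pow]
  ring

lemma weight_nonneg (hm : 0 < m) (hφ : 0 ≤ φ) (n : ℕ) : 0 ≤ weight m φ n := by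
  unfold weight
  positivity

lemma z_eq_rpow (hm : 0 < m) (hφ : |φ| < 1) : z m φ = (1 - φ) ^ (-(m / 2)) := by
  have hsum := hasSum_weight_mul_pow (w := 1) hm (by simpa using hφ)
  have hreal : HasSum (weight m φ) ((1 - φ) ^ (-(m / 2))) := by
    rw [← Complex.hasSum_ofReal,
      Complex.ofReal_cpow (sub_nonneg.2 ((le_abs_self φ).trans hφ.le))]
    simpa using hsum
  exact hreal.tsum_eq

lemma integral_pow_marginal (hm : 0 < m) (hφ0 : 0 ≤ φ) (hφ1 : φ < 1) {w : ℂ} (hw : ‖w‖ ≤ 1) :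
    ∫ n, w ^ n ∂(marginal m φ) = ((1 - φ * w) / (1 - φ)) ^ (-(m / 2) : ℂ) := by
  have hφw : ‖φ * w‖ < 1 := by
    rw [norm_mul, Complex.norm_of_nonneg hφ0]
    exact (mul_le_of_le_one_right hφ0 hw).trans_lt hφ1
  have hpos : 0 < 1 - φ := sub_pos.2 hφ1
  have hz : z m φ = (1 - φ) ^ (-(m / 2)) := z_eq_rpow hm (by rwa [abs_of_nonneg hφ0])
  have hz0 : 0 ≤ z m φ := tsum_nonneg (weight_nonneg hm hφ0)
  have hatom : ∀ n, (ENNReal.ofReal ((z m φ)⁻¹ * weight m φ n)).toReal • w ^ n =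
      (z m φ : ℂ)⁻¹ * (weight m φ n * w ^ n) := fun n => by
    rw [ENNReal.toReal_ofReal (mul_nonneg (inv_nonneg.2 hz0) (weight_nonneg hm hφ0 n)),
      Complex.real_smul]
    push_cast
    ring
  have hbase : (1 - φ * w) / (1 - φ) = ((1 - φ)⁻¹ : ℝ) * (1 - φ * w) := by
    push_cast
    ring
  rw [marginal, integral_sum_dirac (by simp)]
  simp_rw [hatom]
  rw [tsum_mul_left, (hasSum_weight_mul_pow hm hφw).tsum_eq, hz, hbase,
    ofReal_mul_cpow (inv_pos.2 hpos) (sub_ne_zero.2 fun h => by simp [← h] at hφw),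
    Complex.ofReal_inv, Complex.inv_cpow_ofReal_nonneg hpos.le, Complex.ofReal_cpow hpos.le]
  push_cast
  rfl

lemma fugacity_nonneg (hm : 0 < m) (hρ : 0 ≤ ρ) : 0 ≤ fugacity m ρ := by
  unfold fugacity
  positivity

lemma one_sub_fugacity (hm : 0 < m) (hρ : 0 ≤ ρ) : 1 - fugacity m ρ = m / (m + 2 * ρ) := by
  unfold fugacity
  field_simp
  ring

lemma integral_pow_nu (hm : 0 < m) (hρ : 0 ≤ ρ) {w : ℂ} (hw : ‖w‖ ≤ 1) :
    ∫ n, w ^ n ∂(nu m ρ) = (1 + 2 * ρ / m * (1 - w)) ^ (-(m / 2) : ℂ) := by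
  have hsub := one_sub_fugacity hm hρ
  have hlt : fugacity m ρ < 1 := sub_pos.1 (hsub ▸ by positivity)
  have hbase : (1 - fugacity m ρ * w) / (1 - fugacity m ρ) = 1 + 2 * ρ / m * (1 - w) := by
    have hm' : (m : ℂ) ≠ 0 := by exact_mod_cast hm.ne'
    have hmρ : (m + 2 * ρ : ℂ) ≠ 0 := by exact_mod_cast (by positivity : m + 2 * ρ ≠ 0)
    have hφ : fugacity m ρ = 1 - m / (m + 2 * ρ) := by linarith
    rw [hφ]
    push_cast
    rw [sub_sub_cancel]
    field_simp
    ring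
  rw [nu, integral_pow_marginal hm (fugacity_nonneg hm hρ) hlt hw, hbase]

lemma charFun_map_cast_nu (hm : 0 < m) (hρ : 0 ≤ ρ) (t : ℝ) :
    charFun ((nu m ρ).map (Nat.cast : ℕ → ℝ)) t =
      (1 + 2 * ρ / m * (1 - Complex.exp (t * Complex.I))) ^ (-(m / 2) : ℂ) := by
  rw [charFun_apply_real, integral_map Measurable.of_discrete.aemeasurable (by fun_prop),
    ← integral_pow_nu hm hρ (Complex.norm_exp_ofReal_mul_I t).le]
  congr with n
  rw [← Complex.exp_nat_mul]
  congr 1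
  push_cast
  ring

lemma nu_real_compl_singleton_zero (hm : 0 < m) (hρ : 0 ≤ ρ) :
    (nu m ρ).real {0}ᶜ = 1 - (1 + 2 * ρ / m) ^ (-(m / 2)) := by
  have hprob : IsProbabilityMeasure (nu m ρ) := by
    have hone := integral_pow_nu (w := 1) hm hρ (by simp)
    simp only [one_pow, integral_const, sub_self, mul_zero, add_zero, Complex.one_cpow] at hone
    exact isProbabilityMeasure_iff_real.2 (by simpa using hone)
  have hempty : (nu m ρ).real {0} = (1 + 2 * ρ / m) ^ (-(m / 2)) := by
    have hzero := integral_pow_nu (w := 0) hm hρ (by simp)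
    have hindicator : (fun n : ℕ => (0 : ℂ) ^ n) = ({0} : Set ℕ).indicator fun _ => 1 := by
      ext n
      cases n <;> simp
    rw [hindicator, integral_indicator_const _ (measurableSet_singleton 0), Complex.real_smul,
      mul_one, sub_zero, mul_one] at hzero
    apply Complex.ofReal_injective
    rw [hzero, Complex.ofReal_cpow (by positivity)]
    push_cast
    rfl
  rw [probReal_compl_eq_one_sub (measurableSet_singleton 0), hempty]

end NegativeBinomial

section SmallParameter

variable {ρ : ℝ}

lemma isEquivalent_sub_of_hasDerivAt_one {𝕜 : Type*} [NontriviallyNormedField 𝕜] {f : 𝕜 → 𝕜}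
    {x : 𝕜} (hf : HasDerivAt f 1 x) : (fun y => f y - f x) ~[𝓝 x] fun y => y - x := by
  simpa only [smul_eq_mul, mul_one] using! hasDerivAt_iff_isLittleO.1 hf

lemma tendsto_one_div_div_kappa : Tendsto (fun m => 1 / m / kappa m) (𝓝[>] 0) atTop := by
  refine (tendsto_neg_atBot_atTop.comp Real.tendsto_log_nhdsGT_zero).congr' ?_
  filter_upwards [self_mem_nhdsWithin] with m (hm : 0 < m)
  simp only [Function.comp, kappa]
  field_simp

lemma tendsto_one_div_two_mul_kappa : Tendsto (fun m => 1 / (2 * kappa m)) (𝓝[>] 0) (𝓝 0) := by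
  have hlim := (Real.continuous_mul_log.tendsto 0).mono_left (nhdsWithin_le_nhds (s := Set.Ioi 0))
  refine ((hlim.div_const (-2)).congr fun m => ?_).trans (by simp)
  rw [kappa]
  field_simp

lemma log_one_add_div_isEquivalent (hρ : 0 < ρ) :
    (fun m => Real.log (1 + ρ / m)) ~[𝓝[>] 0] fun m => -Real.log m := by
  have hlog : Tendsto (fun m => Real.log (m + ρ)) (𝓝[>] 0) (𝓝 (Real.log ρ)) := by
    have hadd : Tendsto (fun m => m + ρ) (𝓝[>] 0) (𝓝 ρ) :=
      ((continuous_add_const ρ).tendsto' 0 ρ (zero_add ρ)).mono_left nhdsWithin_le_nhds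
    exact hadd.log hρ.ne'
  have hneg : Tendsto (fun m => ‖-Real.log m‖) (𝓝[>] 0) atTop :=
    tendsto_norm_atTop_atTop.comp (tendsto_neg_atBot_atTop.comp Real.tendsto_log_nhdsGT_zero)
  refine (hlog.isBigO_one ℝ |>.trans_isLittleO (isLittleO_const_left.2 (Or.inr hneg))).congr' ?_
    .rfl
  filter_upwards [self_mem_nhdsWithin] with m (hm : 0 < m)
  rw [Pi.sub_apply, one_add_div hm.ne', Real.log_div (by positivity) hm.ne']
  ring

lemma nu_real_compl_singleton_zero_isEquivalent (hρ : 0 < ρ) :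
    (fun m => (nu m ρ).real {0}ᶜ) ~[𝓝[>] 0] fun m => 1 / (2 * kappa m) := by
  have hexponent : (fun m => Real.log (1 + 2 * ρ / m) * -(m / 2)) ~[𝓝[>] 0]
      fun m => -(1 / (2 * kappa m)) := by
    refine ((log_one_add_div_isEquivalent (by positivity : 0 < 2 * ρ)).mul .refl).congr_right ?_
    refine .of_eq (funext fun m => ?_)
    simp only [Pi.mul_apply, kappa]
    field_simp
  have hexponent0 : Tendsto (fun m => Real.log (1 + 2 * ρ / m) * -(m / 2)) (𝓝[>] 0) (𝓝 0) :=
    hexponent.symm.tendsto_nhds (by simpa using tendsto_one_div_two_mul_kappa.neg)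
  have hderiv : HasDerivAt Real.exp 1 0 := by simpa using Real.hasDerivAt_exp 0
  have hexp := (isEquivalent_sub_of_hasDerivAt_one hderiv).comp_tendsto hexponent0
  simp only [Function.comp_def, sub_zero, Real.exp_zero] at hexp
  refine ((hexp.trans hexponent).neg.congr_right (by simp)).congr_left ?_
  filter_upwards [self_mem_nhdsWithin] with m (hm : 0 < m)
  rw [neg_sub, nu_real_compl_singleton_zero hm hρ.le, Real.rpow_def_of_pos (by positivity)]

end SmallParameter

section EmpiricalMean

/-- The defect `K (1 - e^{it/K})`: with `y = ρ * phaseDefect K t` and `s = K m / 2`, the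
characteristic function of the empirical mean `S_K` at `t` is `(1 + y / s) ^ (-s)`. -/
noncomputable def phaseDefect (K : ℕ) (t : ℝ) : ℂ := K * (1 - Complex.exp (t / K * Complex.I))

lemma norm_phaseDefect_le (K : ℕ) (t : ℝ) : ‖phaseDefect K t‖ ≤ |t| := by
  rcases K.eq_zero_or_pos with rfl | hK
  · simp [phaseDefect]
  have hK' : (0 : ℝ) < K := by exact_mod_cast hK
  have hchord : ‖1 - Complex.exp (t / K * Complex.I)‖ ≤ |t| / K := by
    have h := Real.norm_exp_I_mul_ofReal_sub_one_le (x := t / K)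
    rwa [norm_sub_rev, mul_comm Complex.I, Complex.ofReal_div, Complex.ofReal_natCast,
      Real.norm_eq_abs, abs_div, Nat.abs_cast] at h
  rw [phaseDefect, norm_mul, Complex.norm_natCast, mul_comm]
  exact (le_div_iff₀ hK').1 hchord

lemma phaseDefect_re_nonneg (K : ℕ) (t : ℝ) : 0 ≤ (phaseDefect K t).re := by
  have hre : (phaseDefect K t).re = K * (1 - Real.cos (t / K)) := by
    rw [phaseDefect, ← Complex.ofReal_natCast, Complex.re_ofReal_mul, ← Complex.ofReal_div,
      Complex.sub_re, Complex.exp_ofReal_mul_I_re, Complex.one_re]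
  rw [hre]
  exact mul_nonneg K.cast_nonneg (sub_nonneg.2 (Real.cos_le_one _))

lemma tendsto_phaseDefect (t : ℝ) :
    Tendsto (fun K : ℕ => phaseDefect K t) atTop (𝓝 (-(t * Complex.I))) := by
  have harg : Tendsto (fun K : ℕ => (t / K * Complex.I : ℂ)) atTop (𝓝 0) := by
    simpa using (tendsto_const_div_atTop_nhds_zero_nat t).ofReal.mul_const Complex.I
  have hderiv : HasDerivAt Complex.exp 1 0 := by simpa using Complex.hasDerivAt_exp 0
  have hexp := (isEquivalent_sub_of_hasDerivAt_one hderiv).comp_tendsto harg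
  simp only [Function.comp_def, sub_zero, Complex.exp_zero] at hexp
  have hlin : (fun K : ℕ => phaseDefect K t) ~[atTop] fun _ => -(t * Complex.I) := by
    have hmul := (IsEquivalent.refl (u := fun K : ℕ => -(K : ℂ))).mul hexp
    refine (hmul.congr_left ?_).congr_right ?_
    · refine .of_eq (funext fun K => ?_)
      simp only [Pi.mul_apply, phaseDefect]
      ring
    · filter_upwards [eventually_ne_atTop 0] with K hK
      have : (K : ℂ) ≠ 0 := by exact_mod_cast hK
      simp only [Pi.mul_apply]
      field_simp
  exact hlin.symm.tendsto_nhds tendsto_const_nhds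

lemma charFun_map_empiricalMean {Ω : Type*} [MeasurableSpace Ω] {P : Measure Ω}
    {η : ℕ → Ω → ℕ} {m ρ : ℝ} (hm : 0 < m) (hρ : 0 ≤ ρ)
    (hlaw : ∀ i, HasLaw (η i) (nu m ρ) P) (hindep : iIndepFun η P) (K : ℕ) (t : ℝ) :
    charFun (P.map (empiricalMean η K)) t =
      (1 + ρ * phaseDefect K t / (K * m / 2 : ℝ)) ^ (-(K * m / 2 : ℝ) : ℂ) := by
  have hcast : AEMeasurable (Nat.cast : ℕ → ℝ) (nu m ρ) := Measurable.of_discrete.aemeasurable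
  have hsum : AEMeasurable (fun ω => ∑ i ∈ Finset.range K, (η i ω : ℝ)) P :=
    Finset.aemeasurable_fun_sum _ fun i _ =>
      Measurable.of_discrete.comp_aemeasurable (hlaw i).aemeasurable
  have hscale : P.map (empiricalMean η K) =
      (P.map fun ω => ∑ i ∈ Finset.range K, (η i ω : ℝ)).map (1 / (K : ℝ) * ·) :=
    (AEMeasurable.map_map_of_aemeasurable (by fun_prop) hsum).symm
  rw [hscale, charFun_map_mul, charFun_map_sum_range
    (fun i => HasLaw.fun_comp (Y := Nat.cast) ⟨hcast, rfl⟩ (hlaw i))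
    (hindep.comp (fun _ => Nat.cast) fun _ => .of_discrete), charFun_map_cast_nu hm hρ,
    ← Complex.cpow_mul_nat]
  rcases K.eq_zero_or_pos with rfl | hK
  · simp
  have hK' : (K : ℂ) ≠ 0 := by exact_mod_cast hK.ne'
  have hm' : (m : ℂ) ≠ 0 := by exact_mod_cast hm.ne'
  congr 1
  · rw [phaseDefect, one_div_mul_eq_div]
    push_cast
    field_simp
  · push_cast
    ring

variable {ι : Type*} {l : Filter ι} {m : ι → ℝ} {K : ι → ℕ}

lemma tendsto_atTop_of_lt_mul {c : ℝ} (hm : Tendsto m l (𝓝[>] 0)) (hc : 0 < c)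
    (hK : ∀ᶠ i in l, c < K i * m i) : Tendsto K l atTop := by
  rw [← tendsto_natCast_atTop_iff (R := ℝ)]
  refine tendsto_atTop_mono' _ ?_ ((tendsto_inv_nhdsGT_zero.comp hm).const_mul_atTop hc)
  filter_upwards [hK, hm.eventually self_mem_nhdsWithin] with i hi (hmi : 0 < m i)
  rw [Function.comp, ← div_eq_mul_inv, div_le_iff₀ hmi]
  exact hi.le

variable [l.IsCountablyGenerated] {Ω : ι → Type*} [∀ i, MeasurableSpace (Ω i)]
  {P : ∀ i, Measure (Ω i)} [∀ i, IsProbabilityMeasure (P i)] {η : ∀ i, ℕ → Ω i → ℕ} {ρ : ℝ}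

lemma tendstoInLaw_empiricalMean_of_tendsto_cpow {ν : Measure ℝ} [IsProbabilityMeasure ν]
    (hm : Tendsto m l (𝓝[>] 0)) (hρ : 0 ≤ ρ) (hlaw : ∀ i j, HasLaw (η i j) (nu (m i) ρ) (P i))
    (hindep : ∀ i, iIndepFun (η i) (P i))
    (h : ∀ t, Tendsto (fun i => (1 + ρ * phaseDefect (K i) t / (K i * m i / 2 : ℝ)) ^
      (-(K i * m i / 2 : ℝ) : ℂ)) l (𝓝 (charFun ν t))) :
    TendstoInLaw P (fun i ω => empiricalMean (η i) (K i) ω) l ν := by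
  refine tendstoInLaw_of_tendsto_charFun
    (fun i => aemeasurable_empiricalMean (fun j => (hlaw i j).aemeasurable) _) fun t => ?_
  refine (h t).congr' ?_
  filter_upwards [hm.eventually self_mem_nhdsWithin] with i (hmi : 0 < m i)
  exact (charFun_map_empiricalMean hmi hρ (hlaw i) (hindep i) (K i) t).symm

lemma tendstoInLaw_empiricalMean_zero (hm : Tendsto m l (𝓝[>] 0)) (hρ : 0 ≤ ρ)
    (hlaw : ∀ i j, HasLaw (η i j) (nu (m i) ρ) (P i)) (hindep : ∀ i, iIndepFun (η i) (P i))
    (hK : Tendsto (fun i => K i * m i) l (𝓝 0)) :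
    TendstoInLaw P (fun i ω => empiricalMean (η i) (K i) ω) l (Measure.dirac 0) := by
  refine tendstoInLaw_empiricalMean_of_tendsto_cpow hm hρ hlaw hindep fun t => ?_
  have hs : Tendsto (fun i => K i * m i / 2) l (𝓝 0) := by simpa using hK.div_const 2
  have hs0 : ∀ᶠ i in l, 0 ≤ K i * m i / 2 := by
    filter_upwards [hm.eventually self_mem_nhdsWithin] with i (hmi : 0 < m i)
    positivity
  have hlim : charFun (Measure.dirac (0 : ℝ)) t = 1 := by simp [charFun_dirac]
  rw [hlim]
  refine tendsto_one_add_div_cpow_neg_zero (C := ρ * |t|) hs0 hs (fun i => ?_) fun i => ?_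
  · rw [Complex.re_ofReal_mul]
    exact mul_nonneg hρ (phaseDefect_re_nonneg _ _)
  · rw [norm_mul, Complex.norm_of_nonneg hρ]
    exact mul_le_mul_of_nonneg_left (norm_phaseDefect_le _ _) hρ

lemma tendstoInLaw_empiricalMean_gamma (hm : Tendsto m l (𝓝[>] 0)) (hρ : 0 < ρ)
    (hlaw : ∀ i j, HasLaw (η i j) (nu (m i) ρ) (P i)) (hindep : ∀ i, iIndepFun (η i) (P i))
    {γ : ℝ} (hγ : 0 < γ) (hK : Tendsto (fun i => K i * m i) l (𝓝 γ)) :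
    TendstoInLaw P (fun i ω => empiricalMean (η i) (K i) ω) l
      (gammaMeasure (γ / 2) (2 * ρ / γ)⁻¹) := by
  have hrate : 0 < (2 * ρ / γ)⁻¹ := by positivity
  have : IsProbabilityMeasure (gammaMeasure (γ / 2) (2 * ρ / γ)⁻¹) :=
    isProbabilityMeasure_gammaMeasure (half_pos hγ) hrate
  refine tendstoInLaw_empiricalMean_of_tendsto_cpow hm hρ.le hlaw hindep fun t => ?_
  have hy := ((tendsto_phaseDefect t).comp (tendsto_atTop_of_lt_mul hm (half_pos hγ)
    (hK.eventually_const_lt (half_lt_self hγ)))).const_mul (ρ : ℂ)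
  have hs := (hK.div_const 2).ofReal
  have hγ' : (γ : ℂ) ≠ 0 := by exact_mod_cast hγ.ne'
  have hbase : 1 + ρ * -(t * Complex.I) / (γ / 2 : ℝ) =
      1 - t * Complex.I / ((2 * ρ / γ)⁻¹ : ℝ) := by
    push_cast
    field_simp
    ring
  have hslit : 1 + ρ * -(t * Complex.I) / (γ / 2 : ℝ) ∈ Complex.slitPlane := by
    rw [hbase]
    refine Or.inl ?_
    rw [Complex.sub_re, Complex.div_ofReal_re]
    simp
  have hlim := ((hy.div hs (by simpa using hγ')).const_add 1).cpow hs.neg hslit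
  rwa [hbase, ← charFun_gammaMeasure (half_pos hγ) hrate] at hlim

lemma tendstoInLaw_empiricalMean_const (hm : Tendsto m l (𝓝[>] 0)) (hρ : 0 ≤ ρ)
    (hlaw : ∀ i j, HasLaw (η i j) (nu (m i) ρ) (P i)) (hindep : ∀ i, iIndepFun (η i) (P i))
    (hK : Tendsto (fun i => K i * m i) l atTop) :
    TendstoInLaw P (fun i ω => empiricalMean (η i) (K i) ω) l (Measure.dirac ρ) := by
  refine tendstoInLaw_empiricalMean_of_tendsto_cpow hm hρ hlaw hindep fun t => ?_
  have hy := ((tendsto_phaseDefect t).comp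
    (tendsto_atTop_of_lt_mul hm one_pos (hK.eventually_gt_atTop 1))).const_mul (ρ : ℂ)
  have hlim : charFun (Measure.dirac ρ) t = Complex.exp (-(ρ * -(t * Complex.I))) := by
    rw [charFun_dirac]
    simp [mul_comm, mul_left_comm]
  rw [hlim]
  exact tendsto_one_add_div_cpow_neg_atTop (hK.atTop_div_const two_pos) hy

end EmpiricalMean

section OccupiedSites

variable {ι : Type*} {l : Filter ι} {Ω : ι → Type*} [∀ i, MeasurableSpace (Ω i)]
  {P : ∀ i, Measure (Ω i)} [∀ i, IsProbabilityMeasure (P i)] {η : ∀ i, ℕ → Ω i → ℕ}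
  {m : ι → ℝ} {K : ι → ℕ} {ρ : ℝ}

lemma natCast_mul_nu_real_compl_singleton_zero_isEquivalent (hm : Tendsto m l (𝓝[>] 0))
    (hρ : 0 < ρ) :
    (fun i => K i * (nu (m i) ρ).real {0}ᶜ) ~[l] fun i => K i / (2 * kappa (m i)) := by
  have hmul := (IsEquivalent.refl (u := fun i => (K i : ℝ))).mul
    ((nu_real_compl_singleton_zero_isEquivalent hρ).comp_tendsto hm)
  exact hmul.congr_right (.of_eq (funext fun _ => mul_one_div _ _))

lemma tendstoInLaw_numOccupied_nu_poisson [l.IsCountablyGenerated] (hm : Tendsto m l (𝓝[>] 0))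
    (hρ : 0 < ρ) (hlaw : ∀ i j, HasLaw (η i j) (nu (m i) ρ) (P i))
    (hindep : ∀ i, iIndepFun (η i) (P i)) {δ : ℝ} (hδ : 0 ≤ δ)
    (hK : Tendsto (fun i => K i / kappa (m i)) l (𝓝 δ)) :
    TendstoInLaw P (fun i ω => numOccupied (η i) (K i) ω) l
      (poissonMeasure (δ / 2).toNNReal) := by
  have hempty := ((nu_real_compl_singleton_zero_isEquivalent hρ).symm.tendsto_nhds
    tendsto_one_div_two_mul_kappa).comp hm
  refine tendstoInLaw_numOccupied_poisson hlaw hindep hempty ?_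
  refine (natCast_mul_nu_real_compl_singleton_zero_isEquivalent hm hρ).symm.tendsto_nhds ?_
  rw [Real.coe_toNNReal _ (div_nonneg hδ zero_le_two)]
  refine (hK.div_const 2).congr fun i => ?_
  rw [div_div, mul_comm]

lemma tendsto_measure_abs_numOccupied_nu_div_sub_one_ge (hm : Tendsto m l (𝓝[>] 0)) (hρ : 0 < ρ)
    (hlaw : ∀ i j, HasLaw (η i j) (nu (m i) ρ) (P i)) (hindep : ∀ i, iIndepFun (η i) (P i))
    (hK : Tendsto (fun i => K i / (2 * kappa (m i))) l atTop) {ε : ℝ} (hε : 0 < ε) :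
    Tendsto (fun i => P i {ω |
      ε ≤ |(numOccupied (η i) (K i) ω : ℝ) / (K i / (2 * kappa (m i))) - 1|}) l (𝓝 0) :=
  tendsto_measure_abs_numOccupied_div_sub_one_ge hlaw hindep hK
    (natCast_mul_nu_real_compl_singleton_zero_isEquivalent hm hρ) hε

lemma tendstoInLaw_numOccupied_nu_top [l.IsCountablyGenerated] (hm : Tendsto m l (𝓝[>] 0))
    (hρ : 0 < ρ) (hlaw : ∀ i j, HasLaw (η i j) (nu (m i) ρ) (P i))
    (hindep : ∀ i, iIndepFun (η i) (P i))
    (hK : Tendsto (fun i => K i / (2 * kappa (m i))) l atTop) :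
    TendstoInLaw P (fun i ω => (numOccupied (η i) (K i) ω : ℝ≥0∞)) l (Measure.dirac ∞) := by
  refine tendstoInLaw_dirac_top (fun i => Measurable.of_discrete.comp_aemeasurable
    (aemeasurable_numOccupied (fun j => (hlaw i j).aemeasurable) _)) fun c hc => ?_
  have hreal := tendsto_measure_le_of_tendsto_measure_abs_div_sub_one hK (fun ε hε =>
    tendsto_measure_abs_numOccupied_nu_div_sub_one_ge hm hρ hlaw hindep hK hε) c.toReal
  refine hreal.congr fun i => congrArg (P i) (Set.ext fun ω => ?_)
  rw [Set.mem_ofPred_eq, Set.mem_ofPred_eq,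
    ← ENNReal.toReal_le_toReal (ENNReal.natCast_ne_top _) hc.ne, ENNReal.toReal_natCast]

end OccupiedSites

lemma tendsto_coe_toZero : Tendsto (fun m : Param => (m : ℝ)) toZero (𝓝[>] 0) :=
  tendsto_nhdsWithin_iff.2 ⟨tendsto_comap, Eventually.of_forall fun m => m.2⟩

instance isCountablyGenerated_toZero : toZero.IsCountablyGenerated :=
  inferInstanceAs (comap (fun m : Param => (m : ℝ)) (𝓝 0)).IsCountablyGenerated

end InclusionProcess

theorem mainTheorem6 {ρ : ℝ} (hρ : 0 < ρ)
    {Ω : InclusionProcess.Param → Type*} [∀ m, MeasurableSpace (Ω m)]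
    (P : ∀ m, Measure (Ω m)) [∀ m, IsProbabilityMeasure (P m)]
    (η : ∀ m : InclusionProcess.Param, ℕ → Ω m → ℕ)
    (hlaw : ∀ m i, HasLaw (η m i) (InclusionProcess.nu (m : ℝ) ρ) (P m))
    (hindep : ∀ m, iIndepFun (η m) (P m))
    (K : InclusionProcess.Param → ℕ) (hK : ∀ m, 0 < K m) :
    -- the number of occupied sites, on the scale `κ_m`
    (Tendsto (fun m => (K m : ℝ) / InclusionProcess.kappa m) InclusionProcess.toZero (𝓝 0) →
      InclusionProcess.TendstoInLaw P
        (fun m ω => InclusionProcess.numOccupied (η m) (K m) ω)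
        InclusionProcess.toZero (Measure.dirac (0 : ℕ))) ∧
    (∀ δ : ℝ, 0 < δ →
      Tendsto (fun m => (K m : ℝ) / InclusionProcess.kappa m) InclusionProcess.toZero (𝓝 δ) →
      InclusionProcess.TendstoInLaw P
        (fun m ω => InclusionProcess.numOccupied (η m) (K m) ω)
        InclusionProcess.toZero (poissonMeasure (δ / 2).toNNReal)) ∧
    (Tendsto (fun m => (K m : ℝ) / InclusionProcess.kappa m) InclusionProcess.toZero atTop →
      InclusionProcess.TendstoInLaw P
        (fun m ω => (InclusionProcess.numOccupied (η m) (K m) ω : ℝ≥0∞))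
        InclusionProcess.toZero (Measure.dirac (∞ : ℝ≥0∞)) ∧
      ∀ ε : ℝ, 0 < ε →
        Tendsto
          (fun m => P m {ω | ε ≤
            |(InclusionProcess.numOccupied (η m) (K m) ω : ℝ) /
              ((K m : ℝ) / (2 * InclusionProcess.kappa m)) - 1|})
          InclusionProcess.toZero (𝓝 0)) ∧
    -- the scale `1 / m` is larger than `κ_m`
    Tendsto (fun m : InclusionProcess.Param => (1 / (m : ℝ)) / InclusionProcess.kappa m)
      InclusionProcess.toZero atTop ∧
    -- the empirical mean, on the scale `1 / m`
    (Tendsto (fun m => (K m : ℝ) * (m : ℝ)) InclusionProcess.toZero (𝓝 0) →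
      InclusionProcess.TendstoInLaw P
        (fun m ω => InclusionProcess.empiricalMean (η m) (K m) ω)
        InclusionProcess.toZero (Measure.dirac (0 : ℝ))) ∧
    (∀ γ : ℝ, 0 < γ →
      Tendsto (fun m => (K m : ℝ) * (m : ℝ)) InclusionProcess.toZero (𝓝 γ) →
      -- `gammaMeasure` takes shape and rate; the rate is the inverse of the scale `2 ρ / γ`
      InclusionProcess.TendstoInLaw P
        (fun m ω => InclusionProcess.empiricalMean (η m) (K m) ω)
        InclusionProcess.toZero (gammaMeasure (γ / 2) (2 * ρ / γ)⁻¹) ∧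
      Integrable (fun x : ℝ => x) (gammaMeasure (γ / 2) (2 * ρ / γ)⁻¹) ∧
      ∫ x, x ∂(gammaMeasure (γ / 2) (2 * ρ / γ)⁻¹) = ρ) ∧
    (Tendsto (fun m => (K m : ℝ) * (m : ℝ)) InclusionProcess.toZero atTop →
      InclusionProcess.TendstoInLaw P
        (fun m ω => InclusionProcess.empiricalMean (η m) (K m) ω)
        InclusionProcess.toZero (Measure.dirac ρ)) := by
  have hm := InclusionProcess.tendsto_coe_toZero
  have hscale (h : Tendsto (fun m => (K m : ℝ) / InclusionProcess.kappa m)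
      InclusionProcess.toZero atTop) :
      Tendsto (fun m => (K m : ℝ) / (2 * InclusionProcess.kappa m))
        InclusionProcess.toZero atTop :=
    (h.atTop_div_const two_pos).congr fun m => by rw [div_div, mul_comm]
  refine ⟨fun h => ?_, fun δ hδ h => ?_, fun h => ⟨?_, fun ε hε => ?_⟩, ?_, fun h => ?_,
    fun γ hγ h => ⟨?_, ?_, ?_⟩, fun h => ?_⟩
  · simpa [InclusionProcess.poissonMeasure_zero] using
      InclusionProcess.tendstoInLaw_numOccupied_nu_poisson hm hρ hlaw hindep le_rfl h
  · exact InclusionProcess.tendstoInLaw_numOccupied_nu_poisson hm hρ hlaw hindep hδ.le h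
  · exact InclusionProcess.tendstoInLaw_numOccupied_nu_top hm hρ hlaw hindep (hscale h)
  · exact InclusionProcess.tendsto_measure_abs_numOccupied_nu_div_sub_one_ge hm hρ hlaw hindep
      (hscale h) hε
  · exact InclusionProcess.tendsto_one_div_div_kappa.comp hm
  · exact InclusionProcess.tendstoInLaw_empiricalMean_zero hm hρ.le hlaw hindep h
  · exact InclusionProcess.tendstoInLaw_empiricalMean_gamma hm hρ hlaw hindep hγ h
  · exact InclusionProcess.integrable_id_gammaMeasure (by positivity) (by positivity)
  · rw [InclusionProcess.integral_id_gammaMeasure (by positivity) (by positivity)]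
    field_simp
  · exact InclusionProcess.tendstoInLaw_empiricalMean_const hm hρ.le hlaw hindep h
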